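/- Let $l>0$ be a real number and, for $t\in\mathbb{C}$, let $J_t$ be the bounded operator on $\ell^2(\mathbb{N})$ (complex square-summable sequences) defined by multiplication of column vectors by the semi-infinite symmetric tridiagonal (Jacobi) matrix with diagonal entries $t,0,0,0,\ldots$ and off-diagonal entries $a_k=\dfrac{l}{\sqrt{(2k-1)(2k+1)}}$ in positions $(k,k+1)$ and $(k+1,k)$, $k=1,2,3,\ldots$, that is, $$J_t=\begin{pmatrix} t & \frac{l}{\sqrt{1\cdot 3}} & 0 & 0 & \cdots\\ \frac{l}{\sqrt{1\cdot 3}} & 0 & \frac{l}{\sqrt{3\cdot 5}} & 0 & \cdots\\ 0 & \frac{l}{\sqrt{3\cdot 5}} & 0 & \frac{l}{\sqrt{5\cdot 7}} & \cdots\\ \vdots & \vdots & \vdots & \vdots & \ddots\end{pmatrix}.$$ Then $J_t$ has a complete system of eigenvectors (that is, the linear span of all eigenvectors of $J_t$ is dense in $\ell^2(\mathbb{N})$) for every $t\in\mathbb{C}$ except exactly the two values $t=il$ and $t=-il$, for which the system of eigenvectors is not complete. -/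

import Mathlib

noncomputable section

/-- The Hilbert space of square summable complex sequences. -/
abbrev SeqSpace : Type := lp (fun _ : ℕ => ℂ) 2

/-- The semi-infinite complex Jacobi matrix with diagonal entries `b 0, b 1, …` and
off-diagonal entries `a 0, a 1, …` (rows and columns are counted from `0`). -/
def jacobiMatrix (a b : ℕ → ℂ) : Matrix ℕ ℕ ℂ := fun i j =>
  if i = j then b i else if j = i + 1 then a i else if i = j + 1 then a j else 0

theorem jacobiMatrix_row_hasSum (a b : ℕ → ℂ) (x : ℕ → ℂ) (i : ℕ) :
    HasSum (fun j => jacobiMatrix a b i j * x j)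
      (b i * x i + a i * x (i + 1) + if i = 0 then 0 else a (i - 1) * x (i - 1)) := by
  have h1 : HasSum (fun j => if j = i then b i * x i else 0) (b i * x i) :=
    hasSum_ite_eq i _
  have h2 : HasSum (fun j => if j = i + 1 then a i * x (i + 1) else 0) (a i * x (i + 1)) :=
    hasSum_ite_eq (i + 1) _
  have h3 : HasSum (fun j => if j = i - 1 then
      (if i = 0 then 0 else a (i - 1) * x (i - 1)) else 0)
      (if i = 0 then 0 else a (i - 1) * x (i - 1)) :=
    hasSum_ite_eq (i - 1) _
  convert (h1.add h2).add h3 using 1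
  funext j
  unfold jacobiMatrix
  rcases Nat.eq_zero_or_pos i with rfl | hi
  · rcases j with _ | _ | j <;> simp
  · by_cases e1 : i = j
    · subst e1
      have : i ≠ i - 1 := by omega
      simp [this]
    · by_cases e2 : j = i + 1
      · subst e2
        have : i + 1 ≠ i - 1 := by omega
        simp [this]
      · by_cases e3 : i = j + 1
        · subst e3
          simp [e2]
        · have h4 : j ≠ i - 1 := by omega
          simp [e1, e2, e3, h4, Ne.symm e1]

theorem jacobiMatrix_row (a b : ℕ → ℂ) (x : ℕ → ℂ) (i : ℕ) :
    ∑' j, jacobiMatrix a b i j * x j =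
      b i * x i + a i * x (i + 1) + if i = 0 then 0 else a (i - 1) * x (i - 1) :=
  (jacobiMatrix_row_hasSum a b x i).tsum_eq

theorem jacobiMatrix_mul_memℓp {a b : ℕ → ℂ} {C : ℝ} (h : ∀ k, ‖a k‖ + ‖b k‖ ≤ C)
    (x : SeqSpace) :
    Memℓp (fun i => ∑' j, jacobiMatrix a b i j * x j : ℕ → ℂ) 2 := by
  have hmul : ∀ (c y : ℕ → ℂ), (∀ k, ‖c k‖ ≤ C) → Memℓp y 2 →
      Memℓp (fun k => c k * y k : ℕ → ℂ) 2 := by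
    intro c y hc hy
    have hs := (memℓp_gen_iff (p := 2) (by norm_num)).1 hy
    refine memℓp_gen (Summable.of_nonneg_of_le (fun _ => by positivity) ?_
      (hs.mul_left (C ^ (2 : ENNReal).toReal)))
    intro k
    have hC : 0 ≤ C := (norm_nonneg _).trans (hc k)
    rw [norm_mul, Real.mul_rpow (norm_nonneg _) (norm_nonneg _)]
    gcongr
    exact hc k
  have ha : ∀ k, ‖a k‖ ≤ C := fun k => by linarith [h k, norm_nonneg (b k)]
  have hb : ∀ k, ‖b k‖ ≤ C := fun k => by linarith [h k, norm_nonneg (a k)]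
  have hx : Memℓp (fun k => x k : ℕ → ℂ) 2 := lp.memℓp x
  have hs := (memℓp_gen_iff (p := 2) (by norm_num)).1 hx
  have hx1 : Memℓp (fun k => x (k + 1) : ℕ → ℂ) 2 :=
    memℓp_gen ((summable_nat_add_iff 1).2 hs)
  have h1 := hmul b _ hb hx
  have h2 := hmul a _ ha hx1
  have h3 : Memℓp (fun i => if i = 0 then 0 else a (i - 1) * x (i - 1) : ℕ → ℂ) 2 := by
    refine memℓp_gen ((summable_nat_add_iff 1).1 ?_)
    simpa using (memℓp_gen_iff (p := 2) (by norm_num)).1 (hmul a _ ha hx)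
  have := (h1.add h2).add h3
  refine (congrArg (fun f : ℕ → ℂ => Memℓp f 2) ?_).mpr this
  funext i
  rw [jacobiMatrix_row]
  rfl

/-- The linear operator `x ↦ J x` (matrix times column) on the space of square summable
sequences, for a Jacobi matrix `J` with uniformly bounded entries. -/
def jacobiLinearMap (a b : ℕ → ℂ) {C : ℝ} (h : ∀ k, ‖a k‖ + ‖b k‖ ≤ C) :
    SeqSpace →ₗ[ℂ] SeqSpace where
  toFun x := ⟨fun i => ∑' j, jacobiMatrix a b i j * x j, jacobiMatrix_mul_memℓp h x⟩
  map_add' x y := by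
    refine lp.ext (funext fun i => ?_)
    change ∑' j, jacobiMatrix a b i j * (x j + y j) =
      ∑' j, jacobiMatrix a b i j * x j + ∑' j, jacobiMatrix a b i j * y j
    simp only [mul_add]
    exact (jacobiMatrix_row_hasSum a b x i).summable.tsum_add
      (jacobiMatrix_row_hasSum a b y i).summable
  map_smul' c x := by
    refine lp.ext (funext fun i => ?_)
    change ∑' j, jacobiMatrix a b i j * (c * x j) = c * ∑' j, jacobiMatrix a b i j * x j
    simp only [mul_left_comm _ c]
    exact tsum_mul_left

/-- The bounded Jacobi operator `x ↦ J x`. -/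
def jacobiOperator (a b : ℕ → ℂ) {C : ℝ} (h : ∀ k, ‖a k‖ + ‖b k‖ ≤ C) :
    SeqSpace →L[ℂ] SeqSpace :=
  ContinuousLinearMap.ofSeqClosedGraph (g := jacobiLinearMap a b h) <| by
    intro u x y hu hTu
    have hc : ∀ (k : ℕ) (v : ℕ → SeqSpace) (w : SeqSpace),
        Filter.Tendsto v Filter.atTop (nhds w) →
        Filter.Tendsto (fun n => v n k) Filter.atTop (nhds (w k)) := fun k v w hv =>
      ((continuous_apply k).tendsto _).comp
        ((lp.uniformContinuous_coe (E := fun _ : ℕ => ℂ) (p := 2)).continuous.tendsto w |>.comp hv)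
    refine lp.ext (funext fun i => ?_)
    refine tendsto_nhds_unique (hc i _ _ hTu) ?_
    change Filter.Tendsto (fun n => ∑' j, jacobiMatrix a b i j * u n j) Filter.atTop
      (nhds (∑' j, jacobiMatrix a b i j * x j))
    simp only [jacobiMatrix_row]
    refine (((hc i _ _ hu).const_mul _).add ((hc (i + 1) _ _ hu).const_mul _)).add ?_
    split_ifs
    · exact tendsto_const_nhds
    · exact (hc (i - 1) _ _ hu).const_mul _

theorem jacobiOperator_apply (a b : ℕ → ℂ) {C : ℝ} (h : ∀ k, ‖a k‖ + ‖b k‖ ≤ C)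
    (x : SeqSpace) (i : ℕ) :
    jacobiOperator a b h x i = ∑' j, jacobiMatrix a b i j * x j := rfl

/-- Off-diagonal entries `l / √((2k-1)(2k+1))`, `k = 1, 2, …`, the index being shifted to
start from `0`. -/
def offDiag (l : ℝ) (k : ℕ) : ℂ :=
  ((l / Real.sqrt ((2 * (k : ℝ) + 1) * (2 * (k : ℝ) + 3)) : ℝ) : ℂ)

/-- Diagonal entries `t, 0, 0, …`. -/
def diagEntry (t : ℂ) (k : ℕ) : ℂ := if k = 0 then t else 0

theorem offDiag_diagEntry_bound (l : ℝ) (t : ℂ) (k : ℕ) :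
    ‖offDiag l k‖ + ‖diagEntry t k‖ ≤ |l| + ‖t‖ := by
  refine add_le_add ?_ ?_
  · rw [offDiag, Complex.norm_real, Real.norm_eq_abs, abs_div, abs_of_nonneg (Real.sqrt_nonneg _)]
    refine div_le_self (abs_nonneg _) (Real.one_le_sqrt.2 ?_)
    have : (0 : ℝ) ≤ k := k.cast_nonneg
    nlinarith
  · unfold diagEntry
    split_ifs <;> simp

/-- The Jacobi operator `J_t` with diagonal `t, 0, 0, …` and off-diagonal entries
`l / √(1·3), l / √(3·5), l / √(5·7), …`. -/
def perturbedJacobi (l : ℝ) (t : ℂ) : SeqSpace →L[ℂ] SeqSpace :=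
  jacobiOperator (offDiag l) (diagEntry t) (offDiag_diagEntry_bound l t)

/-- The operator `T` has a complete system of eigenvectors: the linear span of all its
eigenvectors (for all eigenvalues) is dense. -/
def HasCompleteEigenvectors {E : Type*} [NormedAddCommGroup E] [NormedSpace ℂ E]
    (T : E →L[ℂ] E) : Prop :=
  (Submodule.span ℂ
    {x : E | ∃ z : ℂ, Module.End.HasEigenvector (T : E →ₗ[ℂ] E) z x}).topologicalClosure = ⊤

end

/-! Rescaling an eigenvector by `x k = √(2k+1) * y k` turns the rows below the first into the
spherical Bessel recurrence at `w = l / z`. A square-summable solution comes from the Legendre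
coefficients of `exp (i w x)` on `(-1, 1]`, with phases (`expCoeff`, `besselSeq`). For it the first
row reads `t sin w = l cos w`.

If `t ≠ ±il`, then `cot w = t / l` is solvable and its solutions include `w + nπ` for every integer
`n`. A vector `g` orthogonal to the resulting eigenvectors is carried by `legendreIsometry` to a
function orthogonal to all `exp (i (w + nπ) x)`. This is the Fourier system times a nonvanishing
factor, so `g = 0` (`eq_zero_of_inner_expVec`). Completeness of the Legendre system is not needed.

If `t = ±il`, there are no eigenvectors at all. For `z ≠ 0`, the constant Casoratian
(`casoratian_const`) makes a decaying solution dependent on `besselSeq w`; the first row then forces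
`t sin w = l cos w`, and squaring contradicts `sin² + cos² = 1`. For `z = 0` the solutions do not
decay. -/

noncomputable section

open Polynomial MeasureTheory
open Set (Ioc)

/-! ### Legendre polynomials: recurrence, orthogonality, norms. -/

/-- The Legendre polynomials, by Rodrigues' formula. -/
def legendrePoly (n : ℕ) : ℝ[X] :=
  C (1 / (2 ^ n * n.factorial : ℝ)) * derivative^[n] ((X ^ 2 - 1) ^ n)

/-- The primitive of the Legendre polynomial of degree `n + 1` which vanishes at `±1`. -/
def legendrePrimitive (n : ℕ) : ℝ[X] :=
  C (1 / (2 ^ (n + 1) * (n + 1).factorial : ℝ)) * derivative^[n] ((X ^ 2 - 1) ^ (n + 1))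

theorem eval_iterate_derivative_eq_zero {m n : ℕ} (h : m < n) {x : ℝ} (hx : x ^ 2 = 1) :
    (derivative^[m] ((X ^ 2 - 1 : ℝ[X]) ^ n)).eval x = 0 := by
  have h1 : (X ^ 2 - 1 : ℝ[X]) ^ (n - m) ∣ derivative^[m] ((X ^ 2 - 1 : ℝ[X]) ^ n) :=
    pow_sub_dvd_iterate_derivative_pow _ _ _
  obtain ⟨q, hq⟩ := (dvd_pow_self (X ^ 2 - 1 : ℝ[X]) (by omega : n - m ≠ 0)).trans h1
  simp [hq, hx]

theorem legendrePrimitive_eval (n : ℕ) {x : ℝ} (hx : x ^ 2 = 1) :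
    (legendrePrimitive n).eval x = 0 := by
  simp only [legendrePrimitive, eval_mul,
    eval_iterate_derivative_eq_zero (Nat.lt_succ_self n) hx, mul_zero]

theorem derivative_legendrePrimitive (n : ℕ) :
    derivative (legendrePrimitive n) = legendrePoly (n + 1) := by
  simp [legendrePrimitive, legendrePoly, Function.iterate_succ_apply']

theorem legendrePoly_zero : legendrePoly 0 = 1 := by simp [legendrePoly]

theorem legendrePoly_one : legendrePoly 1 = X := by
  simp only [legendrePoly, Function.iterate_one, pow_one, derivative_sub, derivative_X_pow,
    derivative_one]
  simp only [Nat.factorial_one, Nat.cast_one, mul_one, sub_zero, Nat.cast_ofNat]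
  norm_num
  rw [← mul_assoc, ← C_mul]
  norm_num

theorem derivative_two_quadratic_pow (n : ℕ) :
    derivative (derivative ((X ^ 2 - 1 : ℝ[X]) ^ (n + 2))) =
      C (2 * (n + 2) * (2 * n + 3) : ℝ) * (X ^ 2 - 1) ^ (n + 1) +
      C (4 * (n + 1) * (n + 2) : ℝ) * (X ^ 2 - 1) ^ n := by
  simp only [derivative_pow, derivative_mul, derivative_sub, derivative_X, derivative_one]
  simp only [map_mul, map_add, map_natCast, map_ofNat, map_one]
  simp only [Nat.add_sub_cancel, show n + 2 - 1 = n + 1 from rfl]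
  simp
  ring

/-- Apply `n` further derivatives to `derivative_two_quadratic_pow`. This one relation yields both
the norms and the Bessel recurrence. -/
theorem legendrePoly_add_two (n : ℕ) :
    legendrePoly (n + 2) = legendrePoly n + C (2 * n + 3 : ℝ) * legendrePrimitive n := by
  simp only [legendrePoly, legendrePrimitive]
  rw [Function.iterate_add_apply derivative n 2, Function.iterate_succ_apply,
    Function.iterate_one, derivative_two_quadratic_pow, iterate_map_add,
    iterate_derivative_C_mul, iterate_derivative_C_mul, mul_add, add_comm]
  have hn : ((n.factorial : ℕ) : ℝ) ≠ 0 := by positivity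
  simp only [← mul_assoc, ← C_mul]
  congr 1
  · congr 2
    rw [Nat.factorial_succ (n + 1), Nat.factorial_succ n]
    push_cast
    field_simp
    ring
  · congr 2
    rw [Nat.factorial_succ (n + 1), Nat.factorial_succ n]
    push_cast
    field_simp
    ring

theorem natDegree_legendrePoly_le (n : ℕ) : (legendrePoly n).natDegree ≤ n := by
  refine (natDegree_C_mul_le _ _).trans ((natDegree_iterate_derivative _ _).trans ?_)
  have h1 : (X ^ 2 - 1 : ℝ[X]).natDegree ≤ 2 := by compute_degree
  have := natDegree_pow_le_of_le n h1
  omega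

theorem integral_eval_mul_derivative (p q : ℝ[X]) (h1 : p.eval 1 = 0) (h2 : p.eval (-1) = 0) :
    ∫ x in (-1 : ℝ)..1, (derivative p).eval x * q.eval x =
      -∫ x in (-1 : ℝ)..1, p.eval x * (derivative q).eval x := by
  have := intervalIntegral.integral_mul_deriv_eq_deriv_mul (a := (-1 : ℝ)) (b := 1)
    (fun x _ => p.hasDerivAt x) (fun x _ => q.hasDerivAt x)
    ((derivative p).continuous.intervalIntegrable _ _)
    ((derivative q).continuous.intervalIntegrable _ _)
  rw [this, h1, h2]
  ring

theorem integral_iterate_derivative_mul (n m : ℕ) (hm : m ≤ n) (q : ℝ[X]) :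
    ∫ x in (-1 : ℝ)..1, (derivative^[m] ((X ^ 2 - 1 : ℝ[X]) ^ n)).eval x * q.eval x =
      (-1) ^ m * ∫ x in (-1 : ℝ)..1, ((X ^ 2 - 1 : ℝ[X]) ^ n).eval x *
        (derivative^[m] q).eval x := by
  induction m generalizing q with
  | zero => simp
  | succ m ih =>
    rw [Function.iterate_succ_apply', integral_eval_mul_derivative _ _
      (eval_iterate_derivative_eq_zero hm (by norm_num))
      (eval_iterate_derivative_eq_zero hm (by norm_num)), ih (by omega),
      Function.iterate_succ_apply, pow_succ]
    ring

theorem integral_legendrePoly_mul_eq_zero {n : ℕ} {q : ℝ[X]} (hq : q.natDegree < n) :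
    ∫ x in (-1 : ℝ)..1, (legendrePoly n).eval x * q.eval x = 0 := by
  simp only [legendrePoly, eval_mul, eval_C, mul_assoc]
  rw [intervalIntegral.integral_const_mul, integral_iterate_derivative_mul n n le_rfl,
    iterate_derivative_eq_zero hq]
  simp

theorem integral_legendrePoly_mul_of_ne {m n : ℕ} (h : m ≠ n) :
    ∫ x in (-1 : ℝ)..1, (legendrePoly m).eval x * (legendrePoly n).eval x = 0 := by
  rcases lt_or_gt_of_ne h with h | h
  · simp_rw [mul_comm ((legendrePoly m).eval _)]
    exact integral_legendrePoly_mul_eq_zero ((natDegree_legendrePoly_le m).trans_lt h)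
  · exact integral_legendrePoly_mul_eq_zero ((natDegree_legendrePoly_le n).trans_lt h)

theorem natDegree_derivative_legendrePoly_le (n : ℕ) :
    (derivative (legendrePoly (n + 1))).natDegree ≤ n :=
  (natDegree_derivative_le _).trans (by have := natDegree_legendrePoly_le (n + 1); omega)

/-- Differentiating `legendrePoly_add_two` leaves a multiple of the Legendre polynomial itself plus
a term of lower degree, which is orthogonal to it. -/
theorem integral_legendrePoly_mul_derivative (n : ℕ) :
    ∫ x in (-1 : ℝ)..1, (legendrePoly n).eval x * (derivative (legendrePoly (n + 1))).eval x =
      (2 * n + 1) * ∫ x in (-1 : ℝ)..1, (legendrePoly n).eval x * (legendrePoly n).eval x := by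
  cases n with
  | zero => simp [legendrePoly_zero, legendrePoly_one]
  | succ n =>
    rw [legendrePoly_add_two, derivative_add, derivative_C_mul, derivative_legendrePrimitive]
    simp only [eval_add, eval_mul, eval_C, mul_add]
    rw [intervalIntegral.integral_add, add_comm]
    · simp only [mul_left_comm _ (2 * (n : ℝ) + 3)]
      rw [intervalIntegral.integral_const_mul,
        integral_legendrePoly_mul_eq_zero (q := derivative (legendrePoly n))]
      · push_cast; ring
      · have := (natDegree_derivative_le (legendrePoly n)).trans (Nat.sub_le _ _)
        have := natDegree_legendrePoly_le n
        omega
    · exact ((legendrePoly _).continuous.mul (Polynomial.continuous _)).intervalIntegrable _ _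
    · refine Continuous.intervalIntegrable ?_ _ _
      fun_prop

theorem integral_legendrePoly_sq (n : ℕ) :
    ∫ x in (-1 : ℝ)..1, (legendrePoly n).eval x * (legendrePoly n).eval x = 2 / (2 * n + 1) := by
  induction n with
  | zero => simp [legendrePoly_zero]; norm_num
  | succ n ih =>
    have h3 : (2 * (n : ℝ) + 3) ≠ 0 := by positivity
    have h1 : (2 * (n : ℝ) + 1) ≠ 0 := by positivity
    have key : (2 * (n : ℝ) + 3) * ∫ x in (-1 : ℝ)..1, (legendrePoly (n + 1)).eval x *
        (legendrePoly (n + 1)).eval x = 2 := by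
      -- Integrating by parts and expanding the primitive by `legendrePoly_add_two` reduces the norm
      -- in degree `n + 1` to that in degree `n`.
      conv_lhs => enter [2, 1, x, 1]; rw [← derivative_legendrePrimitive]
      rw [integral_eval_mul_derivative _ _ (legendrePrimitive_eval n (by norm_num))
        (legendrePrimitive_eval n (by norm_num)), mul_neg, ← intervalIntegral.integral_const_mul]
      have h : ∀ x : ℝ, (2 * (n : ℝ) + 3) * ((legendrePrimitive n).eval x *
          (derivative (legendrePoly (n + 1))).eval x) =
          (legendrePoly (n + 2)).eval x * (derivative (legendrePoly (n + 1))).eval x -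
          (legendrePoly n).eval x * (derivative (legendrePoly (n + 1))).eval x := fun x => by
        rw [legendrePoly_add_two]; simp only [eval_add, eval_mul, eval_C]; ring
      simp_rw [h]
      rw [intervalIntegral.integral_sub
        (Continuous.intervalIntegrable (by fun_prop) _ _)
        (Continuous.intervalIntegrable (by fun_prop) _ _),
        integral_legendrePoly_mul_derivative, ih, integral_legendrePoly_mul_eq_zero]
      · field_simp; ring
      · have := natDegree_derivative_legendrePoly_le n; omega
    rw [eq_div_iff (by positivity), mul_comm]
    push_cast
    linear_combination key

/-! ### Finite Fourier transform of Legendre polynomials. -/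

/-- The finite Fourier transform of the Legendre polynomials. -/
def legendreFourier (w : ℂ) (n : ℕ) : ℂ :=
  ∫ x in (-1 : ℝ)..1, (((legendrePoly n).eval x : ℝ) : ℂ) * Complex.exp (Complex.I * w * x)

theorem hasDerivAt_exp_mul (w : ℂ) (x : ℝ) :
    HasDerivAt (fun x : ℝ => Complex.exp (Complex.I * w * x))
      (Complex.I * w * Complex.exp (Complex.I * w * x)) x := by
  have h := ((Complex.ofRealCLM.hasDerivAt (x := x)).const_mul (Complex.I * w)).cexp
  simpa [mul_comm] using h

theorem integral_derivative_mul_exp (p : ℝ[X]) (w : ℂ) :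
    ∫ x in (-1 : ℝ)..1, (((derivative p).eval x : ℝ) : ℂ) * Complex.exp (Complex.I * w * x) =
      ((p.eval 1 : ℝ) : ℂ) * Complex.exp (Complex.I * w) -
        ((p.eval (-1) : ℝ) : ℂ) * Complex.exp (-(Complex.I * w)) -
      Complex.I * w * ∫ x in (-1 : ℝ)..1, ((p.eval x : ℝ) : ℂ) * Complex.exp (Complex.I * w * x) := by
  have h := intervalIntegral.integral_mul_deriv_eq_deriv_mul (a := (-1 : ℝ)) (b := 1)
    (fun x _ => (p.hasDerivAt x).ofReal_comp) (fun x _ => hasDerivAt_exp_mul w x)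
    (Continuous.intervalIntegrable (by fun_prop) _ _)
    (Continuous.intervalIntegrable (by fun_prop) _ _)
  simp only [mul_left_comm _ (Complex.I * w)] at h
  rw [intervalIntegral.integral_const_mul] at h
  rw [h]
  push_cast
  simp

theorem legendreFourier_zero {w : ℂ} (hw : w ≠ 0) :
    legendreFourier w 0 = 2 * Complex.sin w / w := by
  have h := integral_derivative_mul_exp 1 w
  simp only [derivative_one, eval_zero, Complex.ofReal_zero, zero_mul,
    intervalIntegral.integral_zero] at h
  rw [legendreFourier, legendrePoly_zero, eq_div_iff hw, Complex.sin, mul_comm w Complex.I,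
    neg_mul, mul_comm w Complex.I]
  simp only [eval_one, Complex.ofReal_one, one_mul] at h ⊢
  linear_combination -Complex.I * h +
    (w * ∫ x in (-1 : ℝ)..1, Complex.exp (Complex.I * w * x)) * Complex.I_sq

theorem legendreFourier_one (w : ℂ) :
    legendreFourier w 0 = 2 * Complex.cos w - Complex.I * w * legendreFourier w 1 := by
  have h := integral_derivative_mul_exp X w
  rw [legendreFourier, legendreFourier, legendrePoly_zero, legendrePoly_one, Complex.cos,
    mul_comm w Complex.I, neg_mul, mul_comm w Complex.I]
  simp only [derivative_X] at h
  rw [h]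
  simp
  ring

/-- Integration by parts against the primitive has no boundary terms, since the primitive vanishes
at `±1`. -/
theorem legendreFourier_add_two (w : ℂ) (n : ℕ) :
    (2 * n + 3) * legendreFourier w (n + 1) =
      Complex.I * w * (legendreFourier w n - legendreFourier w (n + 2)) := by
  have h := integral_derivative_mul_exp (legendrePrimitive n) w
  rw [derivative_legendrePrimitive, legendrePrimitive_eval n (by norm_num),
    legendrePrimitive_eval n (by norm_num)] at h
  have h2 : legendreFourier w (n + 2) = legendreFourier w n + (2 * n + 3) *
      ∫ x in (-1 : ℝ)..1, (((legendrePrimitive n).eval x : ℝ) : ℂ) *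
        Complex.exp (Complex.I * w * x) := by
    rw [legendreFourier, legendreFourier, ← intervalIntegral.integral_const_mul,
      ← intervalIntegral.integral_add (Continuous.intervalIntegrable (by fun_prop) _ _)
      (Continuous.intervalIntegrable (by fun_prop) _ _), legendrePoly_add_two]
    congr 1
    ext x
    simp
    ring
  rw [h2, legendreFourier, h]
  simp
  ring

/-! ### Embedding of sequences into square-integrable functions; completeness of shifted
exponentials. -/

theorem Continuous.memLp_restrict_Ioc {f : ℝ → ℂ} (hf : Continuous f) (a b : ℝ) :
    MemLp f 2 (volume.restrict (Ioc a b)) := by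
  obtain ⟨C, hC⟩ := (isCompact_Icc (a := a) (b := b)).exists_bound_of_continuousOn hf.continuousOn
  exact MemLp.of_bound hf.aestronglyMeasurable C
    (ae_restrict_of_forall_mem measurableSet_Ioc fun x hx => hC x (Set.Ioc_subset_Icc_self hx))

/-- The Hilbert space of square integrable functions on the interval `(-1, 1]`. -/
abbrev SqIntegrable : Type := Lp ℂ 2 (volume.restrict (Ioc (-1 : ℝ) 1))

theorem inner_toLp_right (F : SqIntegrable) {g : ℝ → ℂ}
    (hg : MemLp g 2 (volume.restrict (Ioc (-1 : ℝ) 1))) :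
    inner ℂ F (hg.toLp g) = ∫ x in (-1 : ℝ)..1, g x * star (F x) := by
  rw [L2.inner_def, intervalIntegral.integral_of_le (by norm_num)]
  refine integral_congr_ae ?_
  filter_upwards [hg.coeFn_toLp] with x hx
  rw [hx]
  rfl

theorem inner_toLp_toLp {f g : ℝ → ℂ} (hf : MemLp f 2 (volume.restrict (Ioc (-1 : ℝ) 1)))
    (hg : MemLp g 2 (volume.restrict (Ioc (-1 : ℝ) 1))) :
    inner ℂ (hf.toLp f) (hg.toLp g) = ∫ x in (-1 : ℝ)..1, g x * star (f x) := by
  rw [inner_toLp_right, intervalIntegral.integral_of_le (by norm_num),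
    intervalIntegral.integral_of_le (by norm_num)]
  refine integral_congr_ae ?_
  filter_upwards [hf.coeFn_toLp] with x hx
  rw [hx]

/-- The normalized Legendre functions, with phases. -/
def legendreFun (n : ℕ) (x : ℝ) : ℂ :=
  Complex.I ^ n * (Real.sqrt ((2 * n + 1) / 2) : ℝ) * (((legendrePoly n).eval x : ℝ) : ℂ)

theorem continuous_legendreFun (n : ℕ) : Continuous (legendreFun n) := by
  unfold legendreFun
  fun_prop

/-- The normalized Legendre functions as elements of the Hilbert space. -/
def legendreVec (n : ℕ) : SqIntegrable :=
  ((continuous_legendreFun n).memLp_restrict_Ioc (-1) 1).toLp (legendreFun n)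

theorem orthonormal_legendreVec : Orthonormal ℂ legendreVec := by
  classical
  rw [orthonormal_iff_ite]
  intro i j
  rw [legendreVec, legendreVec, inner_toLp_toLp]
  have h : ∀ x : ℝ, legendreFun j x * star (legendreFun i x) =
      (Complex.I ^ j * (Real.sqrt ((2 * j + 1) / 2) : ℝ) * star (Complex.I ^ i) *
        (Real.sqrt ((2 * i + 1) / 2) : ℝ)) *
      (((legendrePoly i).eval x * (legendrePoly j).eval x : ℝ) : ℂ) := fun x => by
    simp only [legendreFun, star_mul', RCLike.star_def, Complex.conj_ofReal, Complex.ofReal_mul]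
    ring
  simp_rw [h]
  rw [intervalIntegral.integral_const_mul, intervalIntegral.integral_ofReal]
  split_ifs with hij
  · subst hij
    have h1 : Complex.I ^ i * star (Complex.I ^ i) = 1 := by
      rw [RCLike.star_def, Complex.mul_conj, Complex.normSq_eq_norm_sq]
      simp
    have h2 : Real.sqrt ((2 * i + 1) / 2) * Real.sqrt ((2 * i + 1) / 2) * (2 / (2 * i + 1)) = 1 := by
      rw [Real.mul_self_sqrt (by positivity)]
      field_simp
    rw [integral_legendrePoly_sq]
    have h3 := congrArg (Complex.ofReal) h2
    rw [Complex.ofReal_mul, Complex.ofReal_mul, Complex.ofReal_one] at h3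
    rw [← h3]
    linear_combination ((Real.sqrt ((2 * i + 1) / 2) : ℝ) * (Real.sqrt ((2 * i + 1) / 2) : ℝ) *
      ((2 / (2 * i + 1) : ℝ) : ℂ)) * h1
  · rw [integral_legendrePoly_mul_of_ne hij]
    simp

/-- The exponential `x ↦ exp (i w x)` as an element of the Hilbert space. -/
def expVec (w : ℂ) : SqIntegrable :=
  ((by fun_prop : Continuous fun x : ℝ => Complex.exp (Complex.I * w * x)).memLp_restrict_Ioc
    (-1) 1).toLp _

theorem inner_legendreVec_expVec (w : ℂ) (n : ℕ) :
    inner ℂ (legendreVec n) (expVec w) =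
      Real.sqrt (2 * n + 1) * ((-Complex.I) ^ n / Real.sqrt 2 * legendreFourier w n) := by
  rw [legendreVec, expVec, inner_toLp_toLp, legendreFourier,
    ← intervalIntegral.integral_const_mul, ← intervalIntegral.integral_const_mul]
  congr 1
  ext x
  simp only [legendreFun, star_mul', RCLike.star_def, Complex.conj_ofReal, map_pow, Complex.conj_I]
  rw [Real.sqrt_div (by positivity)]
  push_cast
  ring

/-- The isometric embedding mapping the standard basis to the normalized Legendre functions. -/
def legendreIsometry : SeqSpace →ₗᵢ[ℂ] SqIntegrable :=
  orthonormal_legendreVec.orthogonalFamily.linearIsometry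

theorem legendreIsometry_single (n : ℕ) :
    legendreIsometry (lp.single 2 n (1 : ℂ)) = legendreVec n := by
  rw [legendreIsometry, OrthogonalFamily.linearIsometry_apply_single]
  simp

/-- The coefficients of an exponential with respect to the Legendre functions. -/
def expCoeff (w : ℂ) : SeqSpace :=
  ContinuousLinearMap.adjoint legendreIsometry.toContinuousLinearMap (expVec w)

theorem inner_expCoeff (g : SeqSpace) (w : ℂ) :
    inner ℂ g (expCoeff w) = inner ℂ (legendreIsometry g) (expVec w) :=
  ContinuousLinearMap.adjoint_inner_right _ _ _

theorem expCoeff_apply (w : ℂ) (n : ℕ) :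
    expCoeff w n =
      Real.sqrt (2 * n + 1) * ((-Complex.I) ^ n / Real.sqrt 2 * legendreFourier w n) := by
  have h := lp.inner_single_left (𝕜 := ℂ) n (1 : ℂ) (expCoeff w)
  rw [inner_expCoeff, legendreIsometry_single, inner_legendreVec_expVec] at h
  rw [h]
  simp

/-- All Fourier coefficients of `exp (i w x) * star F` vanish, so it is zero by Parseval, and the
exponential never vanishes. -/
theorem eq_zero_of_inner_expVec {F : SqIntegrable} {w : ℂ}
    (h : ∀ n : ℤ, inner ℂ F (expVec (w + n * Real.pi)) = 0) : F = 0 := by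
  have hab : (-1 : ℝ) < 1 := by norm_num
  obtain ⟨C, hC⟩ := (isCompact_Icc (a := (-1 : ℝ)) (b := 1)).exists_bound_of_continuousOn
    (by fun_prop : Continuous fun x : ℝ => Complex.exp (Complex.I * w * x)).continuousOn
  have hL : MemLp (fun x : ℝ => Complex.exp (Complex.I * w * x) * star (F x)) 2
      (volume.restrict (Ioc (-1 : ℝ) 1)) := by
    refine (Lp.memLp F).star.of_le_mul (c := C) ?_ ?_
    · exact (by fun_prop : Continuous fun x : ℝ =>
        Complex.exp (Complex.I * w * x)).aestronglyMeasurable.mul (Lp.memLp F).star.1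
    · refine ae_restrict_of_forall_mem measurableSet_Ioc fun x hx => ?_
      rw [norm_mul]
      exact mul_le_mul_of_nonneg_right (hC x (Set.Ioc_subset_Icc_self hx)) (norm_nonneg _)
  have hc : ∀ n : ℤ, fourierCoeffOn hab
      (fun x : ℝ => Complex.exp (Complex.I * w * x) * star (F x)) n = 0 := by
    intro n
    rw [fourierCoeffOn_eq_integral]
    -- The `n`-th Fourier coefficient integrates against `exp (-iπnx)`, hence the sign.
    have := h (-n)
    rw [expVec, inner_toLp_right] at this
    rw [← smul_zero (1 / (1 - (-1 : ℝ))), ← this]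
    congr 2
    ext x
    rw [fourier_coe_apply, smul_eq_mul, ← mul_assoc, ← Complex.exp_add]
    congr 2
    push_cast
    ring
  have hs := hasSum_sq_fourierCoeffOn hab hL
  simp only [hc, norm_zero, ne_eq, OfNat.ofNat_ne_zero, not_false_eq_true, zero_pow] at hs
  have h0 := hs.unique hasSum_zero
  rw [smul_eq_zero, intervalIntegral.integral_of_le hab.le] at h0
  replace h0 := h0.resolve_left (by norm_num)
  rw [integral_eq_zero_iff_of_nonneg (fun x => by positivity)
    (by simpa using hL.integrable_norm_pow (by norm_num))] at h0
  refine (Lp.eq_zero_iff_ae_eq_zero).2 ?_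
  filter_upwards [h0] with x hx
  simpa [Complex.exp_ne_zero] using hx

/-! ### The eigenvalue equation and spherical Bessel functions. -/

theorem perturbedJacobi_apply_zero (l : ℝ) (t : ℂ) (x : SeqSpace) :
    perturbedJacobi l t x 0 = t * x 0 + offDiag l 0 * x 1 := by
  rw [perturbedJacobi, jacobiOperator_apply, jacobiMatrix_row]
  simp [diagEntry]

theorem perturbedJacobi_apply_succ (l : ℝ) (t : ℂ) (x : SeqSpace) (k : ℕ) :
    perturbedJacobi l t x (k + 1) = offDiag l (k + 1) * x (k + 2) + offDiag l k * x k := by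
  rw [perturbedJacobi, jacobiOperator_apply, jacobiMatrix_row]
  simp [diagEntry]

theorem offDiag_eq (l : ℝ) (k : ℕ) :
    offDiag l k = (l : ℂ) / (Real.sqrt (2 * k + 1) * Real.sqrt (2 * k + 3)) := by
  rw [offDiag, Real.sqrt_mul (by positivity)]
  push_cast
  rfl

theorem ofReal_sqrt_ne_zero {r : ℝ} (hr : 0 < r) : (Real.sqrt r : ℂ) ≠ 0 :=
  Complex.ofReal_ne_zero.2 (Real.sqrt_pos.2 hr).ne'

theorem perturbedJacobi_eq_smul_iff {l : ℝ} {t z : ℂ} {x : SeqSpace} {y : ℕ → ℂ}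
    (hx : ∀ k : ℕ, x k = Real.sqrt (2 * k + 1) * y k) :
    perturbedJacobi l t x = z • x ↔ t * y 0 + l * y 1 = z * y 0 ∧
      ∀ k : ℕ, l * (y k + y (k + 2)) = z * (2 * k + 3) * y (k + 1) := by
  have h0 : perturbedJacobi l t x 0 = (z • x) 0 ↔ t * y 0 + l * y 1 = z * y 0 := by
    have h3 := ofReal_sqrt_ne_zero (r := 3) (by norm_num)
    have e : perturbedJacobi l t x 0 = t * y 0 + l * y 1 := by
      rw [perturbedJacobi_apply_zero, hx, hx, offDiag_eq]
      norm_num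
      field_simp
    rw [e, lp.coeFn_smul, Pi.smul_apply, hx]
    simp
  have h1 : ∀ k : ℕ, perturbedJacobi l t x (k + 1) = (z • x) (k + 1) ↔
      l * (y k + y (k + 2)) = z * (2 * k + 3) * y (k + 1) := by
    intro k
    have hk1 := ofReal_sqrt_ne_zero (r := 2 * k + 1) (by positivity)
    have hk3 := ofReal_sqrt_ne_zero (r := 2 * k + 3) (by positivity)
    have hk5 := ofReal_sqrt_ne_zero (r := 2 * k + 5) (by positivity)
    have e : perturbedJacobi l t x (k + 1) = l * (y k + y (k + 2)) / Real.sqrt (2 * k + 3) := by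
      rw [perturbedJacobi_apply_succ, hx, hx, offDiag_eq, offDiag_eq]
      push_cast
      rw [show 2 * ((k : ℝ) + 1) + 1 = 2 * k + 3 by ring,
        show 2 * ((k : ℝ) + 1) + 3 = 2 * k + 5 by ring,
        show 2 * ((k : ℝ) + 2) + 1 = 2 * k + 5 by ring]
      field_simp
      ring
    have hsq : (Real.sqrt (2 * k + 3) : ℂ) * Real.sqrt (2 * k + 3) = 2 * k + 3 := by
      rw [← Complex.ofReal_mul, Real.mul_self_sqrt (by positivity)]
      push_cast
      ring
    rw [e, lp.coeFn_smul, Pi.smul_apply, hx, div_eq_iff hk3, smul_eq_mul]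
    push_cast
    rw [show 2 * ((k : ℝ) + 1) + 1 = 2 * k + 3 by ring, ← hsq]
    ring_nf
  constructor
  · intro h
    exact ⟨h0.1 (by rw [h]), fun k => (h1 k).1 (by rw [h])⟩
  · rintro ⟨ha, hb⟩
    refine lp.ext (funext fun k => ?_)
    cases k with
    | zero => exact h0.2 ha
    | succ k => exact (h1 k).2 (hb k)

/-- The coefficients of an exponential without the normalizing square roots; up to a constant
these are the spherical Bessel functions of `w`. -/
def besselSeq (w : ℂ) (n : ℕ) : ℂ := (-Complex.I) ^ n / Real.sqrt 2 * legendreFourier w n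

/-- The phase `(-i)^n` turns the difference in `legendreFourier_add_two` into a sum and removes the
factor `i`. -/
theorem besselSeq_add_two (w : ℂ) (n : ℕ) :
    w * (besselSeq w n + besselSeq w (n + 2)) = (2 * n + 3) * besselSeq w (n + 1) := by
  have h := legendreFourier_add_two w n
  simp only [besselSeq, pow_succ]
  linear_combination ((-Complex.I) ^ n / Real.sqrt 2) * Complex.I * h +
    ((-Complex.I) ^ n / Real.sqrt 2) * w * legendreFourier w n * Complex.I_sq

theorem besselSeq_zero {w : ℂ} (hw : w ≠ 0) :
    w * besselSeq w 0 = 2 / Real.sqrt 2 * Complex.sin w := by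
  rw [besselSeq, legendreFourier_zero hw]
  field_simp

theorem besselSeq_one (w : ℂ) :
    w * besselSeq w 1 = besselSeq w 0 - 2 / Real.sqrt 2 * Complex.cos w := by
  have h := legendreFourier_one w
  simp only [besselSeq, pow_zero, pow_one]
  linear_combination (-1 / Real.sqrt 2 : ℂ) * h

theorem hasEigenvector_expCoeff {l : ℝ} (hl : 0 < l) {t w : ℂ}
    (hw : t * Complex.sin w = l * Complex.cos w) :
    Module.End.HasEigenvector (perturbedJacobi l t : SeqSpace →ₗ[ℂ] SeqSpace) (l / w)
      (expCoeff w) := by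
  have hl' : (l : ℂ) ≠ 0 := Complex.ofReal_ne_zero.2 hl.ne'
  have hw0 : w ≠ 0 := by
    rintro rfl
    exact hl' (by simpa using hw.symm)
  have h2 := ofReal_sqrt_ne_zero (r := 2) (by norm_num)
  have hb0 := besselSeq_zero hw0
  have hb1 := besselSeq_one w
  rw [Module.End.hasEigenvector_iff, Module.End.mem_eigenspace_iff]
  constructor
  · refine (perturbedJacobi_eq_smul_iff (y := besselSeq w) (expCoeff_apply w)).2 ⟨?_, fun k => ?_⟩
    · field_simp
      linear_combination t * hb0 + l * hb1 + 2 / Real.sqrt 2 * hw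
    · have := besselSeq_add_two w k
      field_simp
      linear_combination this
  · intro h
    have h0 : expCoeff w 0 = 0 := by rw [h]; rfl
    -- A vanishing zeroth coefficient would give `sin w = 0`, and then the hypothesis gives `cos w =
    -- 0` too.
    have hs : Complex.sin w = 0 := by
      have h3 : besselSeq w 0 = 0 := by
        rw [expCoeff_apply] at h0
        simpa [besselSeq] using h0
      rw [h3, mul_zero] at hb0
      simpa using hb0.symm
    have hc : Complex.cos w = 0 := by
      rw [hs, mul_zero] at hw
      exact (mul_eq_zero.1 hw.symm).resolve_left hl'
    have := Complex.sin_sq_add_cos_sq w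
    simp [hs, hc] at this

theorem hasCompleteEigenvectors_perturbedJacobi {l : ℝ} (hl : 0 < l) {t : ℂ}
    (h1 : t ≠ Complex.I * l) (h2 : t ≠ -(Complex.I * l)) :
    HasCompleteEigenvectors (perturbedJacobi l t) := by
  have hl' : (l : ℂ) ≠ 0 := Complex.ofReal_ne_zero.2 hl.ne'
  obtain ⟨w, hw⟩ : ∃ w : ℂ, t * Complex.sin w = l * Complex.cos w := by
    -- This solves `cot w = t / l`; the tangent omits only the values `±i`.
    refine ⟨Real.pi / 2 - Complex.arctan (t / l), ?_⟩
    rw [Complex.sin_pi_div_two_sub, Complex.cos_pi_div_two_sub]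
    have h := Complex.tan_arctan (z := t / l) (by rwa [Ne, div_eq_iff hl'])
      (by rwa [Ne, div_eq_iff hl', neg_mul])
    -- If the cosine were zero, division by zero would make the tangent, hence `t / l`, equal to
    -- `0`; but `cos (arctan 0) = 1`.
    have hc : Complex.cos (Complex.arctan (t / l)) ≠ 0 := by
      intro hc
      rw [Complex.tan_eq_sin_div_cos, hc, div_zero] at h
      rw [← h] at hc
      simp [Complex.arctan] at hc
    rw [Complex.tan_eq_sin_div_cos, div_eq_div_iff hc hl'] at h
    linear_combination -h
  have hwn : ∀ n : ℤ, t * Complex.sin (w + n * Real.pi) = l * Complex.cos (w + n * Real.pi) := by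
    intro n
    rw [Complex.sin_antiperiodic.add_int_mul_eq, Complex.cos_antiperiodic.add_int_mul_eq]
    linear_combination ((n.negOnePow : ℤ) : ℂ) * hw
  rw [HasCompleteEigenvectors, Submodule.topologicalClosure_eq_top_iff, Submodule.eq_bot_iff]
  intro g hg
  rw [Submodule.mem_orthogonal'] at hg
  have : legendreIsometry g = 0 := eq_zero_of_inner_expVec (w := w) fun n => by
    rw [← inner_expCoeff]
    exact hg _ (Submodule.subset_span ⟨_, hasEigenvector_expCoeff hl (hwn n)⟩)
  exact legendreIsometry.injective (by rw [this, map_zero])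

/-! ### The exceptional values: absence of eigenvectors. -/

theorem tendsto_zero_of_eq_sqrt_mul {x : SeqSpace} {y : ℕ → ℂ}
    (hx : ∀ k : ℕ, x k = Real.sqrt (2 * k + 1) * y k) :
    Filter.Tendsto y Filter.atTop (nhds 0) := by
  have hs := (memℓp_gen_iff (p := 2) (by norm_num)).1 (lp.memℓp x)
  have h0 : Filter.Tendsto (fun k => ‖x k‖) Filter.atTop (nhds 0) := by
    have h := hs.tendsto_atTop_zero.sqrt
    simpa [Real.sqrt_sq] using h
  refine squeeze_zero_norm (fun k => ?_) h0
  rw [hx, norm_mul, Complex.norm_real, Real.norm_of_nonneg (Real.sqrt_nonneg _)]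
  refine le_mul_of_one_le_left (norm_nonneg _) (Real.one_le_sqrt.2 ?_)
  have : (0 : ℝ) ≤ k := k.cast_nonneg
  linarith

/-- The norm is constant along steps of two, so decay forces it to be zero. -/
theorem eq_zero_of_recurrence_zero {y : ℕ → ℂ} (hy : Filter.Tendsto y Filter.atTop (nhds 0))
    (h : ∀ k, y k + y (k + 2) = 0) (k : ℕ) : y k = 0 := by
  have h1 : ∀ m : ℕ, ‖y (k + 2 * m)‖ = ‖y k‖ := by
    intro m
    induction m with
    | zero => rfl
    | succ m ih =>
      rw [← ih, mul_add, ← add_assoc, mul_one, eq_neg_of_add_eq_zero_right (h (k + 2 * m)),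
        norm_neg]
  have h2 : Filter.Tendsto (fun m : ℕ => ‖y (k + 2 * m)‖) Filter.atTop (nhds 0) := by
    have := (hy.comp (Filter.tendsto_atTop_mono (fun m : ℕ => (by omega : m ≤ k + 2 * m))
      Filter.tendsto_id)).norm
    simpa using this
  simp_rw [h1] at h2
  exact norm_eq_zero.1 (tendsto_nhds_unique tendsto_const_nhds h2)

/-- Discrete Wronskian identity: the middle coefficients `2k + 3` cancel between the two
recurrences. -/
theorem casoratian_const {w : ℂ} (hw : w ≠ 0) {y v : ℕ → ℂ}
    (hy : ∀ k : ℕ, w * (y k + y (k + 2)) = (2 * k + 3) * y (k + 1))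
    (hv : ∀ k : ℕ, w * (v k + v (k + 2)) = (2 * k + 3) * v (k + 1)) (k : ℕ) :
    y k * v (k + 1) - y (k + 1) * v k = y 0 * v 1 - y 1 * v 0 := by
  induction k with
  | zero => rfl
  | succ k ih =>
    rw [← ih]
    apply mul_left_cancel₀ hw
    linear_combination y (k + 1) * hv k - v (k + 1) * hy k

theorem eq_zero_of_perturbedJacobi_eq_smul {l : ℝ} (hl : 0 < l) {t z : ℂ}
    (ht : t ^ 2 = -(l : ℂ) ^ 2) {x : SeqSpace} (hx : perturbedJacobi l t x = z • x) : x = 0 := by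
  have hl' : (l : ℂ) ≠ 0 := Complex.ofReal_ne_zero.2 hl.ne'
  have hr : ∀ k : ℕ, (Real.sqrt (2 * k + 1) : ℂ) ≠ 0 := fun k =>
    ofReal_sqrt_ne_zero (by positivity)
  obtain ⟨y, hy⟩ : ∃ y : ℕ → ℂ, ∀ k : ℕ, x k = Real.sqrt (2 * k + 1) * y k :=
    ⟨fun k => x k / Real.sqrt (2 * k + 1), fun k => by rw [mul_div_cancel₀ _ (hr k)]⟩
  have hlim := tendsto_zero_of_eq_sqrt_mul hy
  obtain ⟨h0, hk⟩ := (perturbedJacobi_eq_smul_iff hy).1 hx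
  suffices hyz : ∀ k, y k = 0 by
    refine lp.ext (funext fun k => ?_)
    rw [hy, hyz, mul_zero]
    rfl
  by_cases hz : z = 0
  · subst hz
    refine eq_zero_of_recurrence_zero hlim fun k => ?_
    have := hk k
    rw [zero_mul, zero_mul] at this
    exact (mul_eq_zero.1 this).resolve_left hl'
  obtain ⟨w, hw⟩ : ∃ w : ℂ, w * z = l := ⟨l / z, div_mul_cancel₀ _ hz⟩
  have hw0 : w ≠ 0 := by
    rintro rfl
    exact hl' (by rw [← hw, zero_mul])
  have hrec : ∀ k : ℕ, w * (y k + y (k + 2)) = (2 * k + 3) * y (k + 1) := fun k => by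
    apply mul_left_cancel₀ hz
    linear_combination hk k + (y k + y (k + 2)) * hw
  have hlim1 : ∀ u : ℕ → ℂ, Filter.Tendsto u Filter.atTop (nhds 0) →
      Filter.Tendsto (fun k => u (k + 1)) Filter.atTop (nhds 0) := fun u hu =>
    (Filter.tendsto_add_atTop_iff_nat 1).2 hu
  have hb : Filter.Tendsto (besselSeq w) Filter.atTop (nhds 0) :=
    tendsto_zero_of_eq_sqrt_mul (expCoeff_apply w)
  -- The Casoratian is constant and, both sequences decaying, tends to zero.
  have hc : y 0 * besselSeq w 1 - y 1 * besselSeq w 0 = 0 := by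
    have h := (hlim.mul (hlim1 _ hb)).sub ((hlim1 _ hlim).mul hb)
    simp_rw [casoratian_const hw0 hrec (besselSeq_add_two w)] at h
    simpa using tendsto_nhds_unique tendsto_const_nhds h
  have hy1 : l * (w * y 1) = l * y 0 - w * t * y 0 := by
    linear_combination w * h0 + y 0 * hw
  have h2 := ofReal_sqrt_ne_zero (r := 2) (by norm_num)
  have hy0 : y 0 = 0 := by
    have hmul : y 0 * (t * Complex.sin w - l * Complex.cos w) = 0 := by
      have : (2 / Real.sqrt 2 : ℂ) * (y 0 * (t * Complex.sin w - l * Complex.cos w)) = 0 := by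
        linear_combination l * w * hc - l * y 0 * besselSeq_one w + besselSeq w 0 * hy1 -
          t * y 0 * besselSeq_zero hw0
      exact (mul_eq_zero.1 this).resolve_left (div_ne_zero two_ne_zero h2)
    refine (mul_eq_zero.1 hmul).resolve_right fun h => ?_
    -- Squaring `t sin w = l cos w` and using `t² = -l²`.
    have hne : (l : ℂ) ^ 2 * (Complex.sin w ^ 2 + Complex.cos w ^ 2) = 0 := by
      linear_combination -(t * Complex.sin w + l * Complex.cos w) * h + Complex.sin w ^ 2 * ht
    rw [Complex.sin_sq_add_cos_sq, mul_one] at hne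
    exact pow_ne_zero 2 hl' hne
  have hy1' : y 1 = 0 := by
    rw [hy0, mul_zero, mul_zero, sub_zero] at hy1
    simpa [hl', hw0] using hy1
  intro k
  induction k using Nat.twoStepInduction with
  | zero => exact hy0
  | one => exact hy1'
  | more k ih1 ih2 =>
    have := hrec k
    rw [ih1, ih2, mul_zero, zero_add] at this
    exact (mul_eq_zero.1 this).resolve_left hw0

theorem not_hasCompleteEigenvectors_perturbedJacobi {l : ℝ} (hl : 0 < l) {t : ℂ}
    (ht : t ^ 2 = -(l : ℂ) ^ 2) : ¬ HasCompleteEigenvectors (perturbedJacobi l t) := by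
  have he : {x : SeqSpace | ∃ z : ℂ, Module.End.HasEigenvector
      (perturbedJacobi l t : SeqSpace →ₗ[ℂ] SeqSpace) z x} = ∅ := by
    refine Set.eq_empty_of_forall_notMem ?_
    rintro x ⟨z, hx⟩
    exact hx.2 (eq_zero_of_perturbedJacobi_eq_smul hl ht hx.apply_eq_smul)
  rw [HasCompleteEigenvectors, he, Submodule.span_empty, Submodule.topologicalClosure_eq_top_iff,
    Submodule.bot_orthogonal_eq_top]
  intro h
  -- The span of no eigenvectors is zero, so density would make the whole space trivial.
  have h1 : lp.single 2 0 (1 : ℂ) = (0 : SeqSpace) := (Submodule.mem_bot ℂ).1 (h ▸ Submodule.mem_top)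
  have h2 := congrArg (fun f : SeqSpace => f 0) h1
  simp at h2

end

theorem mainTheorem6 (l : ℝ) (hl : 0 < l) (t : ℂ) :
    HasCompleteEigenvectors (perturbedJacobi l t) ↔
      t ≠ Complex.I * (l : ℂ) ∧ t ≠ -(Complex.I * (l : ℂ)) := by
  refine ⟨fun h => ⟨?_, ?_⟩, fun h => hasCompleteEigenvectors_perturbedJacobi hl h.1 h.2⟩
  · rintro rfl
    exact not_hasCompleteEigenvectors_perturbedJacobi hl (by simp [mul_pow]) h
  · rintro rfl
    exact not_hasCompleteEigenvectors_perturbedJacobi hl (by simp [mul_pow]) h
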